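/- All graphs are finite and simple. $P_t$ and $C_t$ denote the path and the cycle on $t$ vertices, and a diamond is the graph obtained from two triangles that share exactly one edge ($K_4$ minus an edge). A graph is $(H_1,\dots,H_k)$-free if none of its induced subgraphs is isomorphic to any $H_i$. A clique cutset of a graph $G$ is a clique $K$ of $G$ such that $G-K$ has more connected components than $G$. Let $F$ be the graph consisting of a cycle $v_1v_2v_3v_4v_5v_6v_7v_1$ (without chords) and a stable set $\{y_1,y_2,y_3\}$ of three further vertices, where the neighbours of $y_1$ are exactly $v_1,v_4,v_5$, those of $y_2$ are exactly $v_2,v_5,v_6$, and those of $y_3$ are exactly $v_3,v_6,v_7$. **Theorem 1.** Let $G$ be a connected $(P_7, C_4, \text{diamond})$-free graph without clique cutsets. If $G$ is isomorphic to neither $F$ nor the Petersen graph, then $\delta(G)\le \max\{2,\ \omega(G)-1\}$, where $\delta(G)$ is the minimum degree and $\omega(G)$ the clique number (the maximum size of a clique) of $G$. -/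

import Mathlib

/-- `G` is `H`-free: no induced subgraph of `G` is isomorphic to `H`. -/
def InducedFree {W V : Type*} (H : SimpleGraph W) (G : SimpleGraph V) : Prop :=
  ¬ H.IsIndContained G

/-- The diamond: two triangles sharing exactly one edge, i.e. `K₄` minus an edge. -/
def diamondGraph : SimpleGraph (Fin 4) :=
  (⊤ : SimpleGraph (Fin 4)).deleteEdges {s(0, 1)}

/-- The Petersen graph: the vertices are the 2-element subsets of a 5-element set, adjacent
when disjoint. -/
def petersenGraph : SimpleGraph {s : Finset (Fin 5) // s.card = 2} where
  Adj s t := Disjoint s.1 t.1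
  symm := ⟨fun _ _ h => h.symm⟩
  loopless := ⟨fun s h => by
    have h0 : s.1 = ∅ := by simpa using h
    have h2 := s.2
    simp [h0] at h2⟩

/-- The neighbours on the 7-cycle `v₁, …, v₇` of the three extra vertices `y₁, y₂, y₃` of `F`;
the vertex `vᵢ` is represented by `i - 1`. -/
def sevenHoleNbrs : Fin 3 → Finset (Fin 7) :=
  ![{0, 3, 4}, {1, 4, 5}, {2, 5, 6}]

/-- The graph `F`: a 7-cycle `v₁, …, v₇` together with a stable set `{y₁, y₂, y₃}` such that
`y₁` is adjacent to `v₁, v₄, v₅`, `y₂` to `v₂, v₅, v₆`, and `y₃` to `v₃, v₆, v₇`. -/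
def sevenHoleGraphF : SimpleGraph (Fin 7 ⊕ Fin 3) where
  Adj
    | .inl i, .inl j => (SimpleGraph.cycleGraph 7).Adj i j
    | .inl i, .inr k => i ∈ sevenHoleNbrs k
    | .inr k, .inl i => i ∈ sevenHoleNbrs k
    | .inr _, .inr _ => False
  symm := ⟨by
    rintro (i | k) (j | l) h
    · exact SimpleGraph.Adj.symm h
    · exact h
    · exact h
    · exact h⟩
  loopless := ⟨by
    rintro (i | k) h
    · exact SimpleGraph.irrefl _ h
    · exact h⟩

/-- `K` is a clique cutset of `G`: a clique whose deletion leaves a graph with more connected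
components than `G`. -/
def IsCliqueCutset {V : Type*} (G : SimpleGraph V) (K : Set V) : Prop :=
  G.IsClique K ∧
    Nat.card G.ConnectedComponent < Nat.card (G.induce Kᶜ).ConnectedComponent

/-!
Let `G` violate the bound. Then every vertex has at least three neighbours, and no neighbourhood is
a clique, since a clique neighbourhood of `v` would give a clique with `deg v + 1 > ω` vertices.
Moreover, two distinct nonadjacent vertices have at most one common neighbour: two of them would
span, together with the given pair, a `C₄` or a diamond. These three facts are collected in
`Admissible G`; they imply that for every edge `vc` some other neighbour of `v` is not adjacent
to `c`. A connected `P₇`-free graph with these properties is the Petersen graph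
(`Admissible.nonempty_iso_petersenGraph`). The graph `F` does not turn up, since it contains the
induced path `v₁ v₇ y₃ v₃ v₄ v₅ y₂`.

That `G` is the Petersen graph is proved by an exhaustive search. A configuration is a labelled
graph `A` on few vertices, and `Realizes G n A f` says that `f` embeds it in `G` as an induced subgraph. If the
neighbours of a vertex `v` inside the configuration form a clique, or if there are just two of them,
then `v` has a neighbour `x` outside, and in the first case `x` may be taken nonadjacent to a
prescribed neighbour of `v`. The search runs through all adjacencies between `x` and the
configuration, discards those that break the uniqueness of common neighbours or complete an induced
path that is known to be absent, and continues with the enlarged configurations. If it ends, then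
`G` contains one of the configurations without such a vertex `v` at which it stops
(`exists_final_of_search`); this is a contradiction if all branches die. Three computations of this
kind suffice:

* starting from an induced `P₆` in a `P₇`-free graph, every branch dies, so that `G` is `P₆`-free;
* starting from a single vertex in a `P₆`-free graph, every branch dies or ends in the
  Petersen graph;
* in a `P₆`-free graph, no vertex outside an induced Petersen graph has a neighbour in it.

By connectedness, `G` is the Petersen graph. The computations are run by the kernel, which is why
the functions below work on bit sets with the binary operations on `ℕ` that the kernel evaluates
natively. Induced paths and Petersen graphs inside a configuration are sought by backtracking whose
correctness is not needed, because every path or labelling found is checked.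
-/

namespace InducedSearch

/-! ### Bit sets -/

/-- Application `k a`, written so that the kernel first evaluates `a` to a numeral. Without it,
unevaluated arguments would be copied. -/
def strict {α : Type} (a : ℕ) (k : ℕ → α) : α := Nat.rec (k 0) (fun m _ => k m.succ) a

/-- The bit set `{i}`. A natural number stands for the set of the positions of its binary ones. -/
def bit (i : ℕ) : ℕ := Nat.pow 2 i

/-- Membership of `i` in the bit set `s`. -/
def mem (s i : ℕ) : Bool := Nat.beq (Nat.land (Nat.shiftRight s i) 1) 1

/-- The difference of the bit sets `s` and `t`. -/
def diff (s t : ℕ) : ℕ := Nat.xor s (Nat.land s t)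

/-- The set of neighbours of `i` in the graph on `{0, …, 15}` encoded by `A`: the vertices `i` and
`j` are adjacent when the bit `16 * i + j` of `A` is set. -/
def row (A i : ℕ) : ℕ := Nat.mod (Nat.shiftRight A (Nat.mul 16 i)) 65536

/-- The first nonempty list among the `k i` with `i` in the bit set `s`, or `[]` if there is none.
The first argument bounds the number of elements that are tried. -/
def firstSome : ℕ → ℕ → (ℕ → List ℕ) → List ℕ
  | 0, _, _ => []
  | t + 1, s, k => bif Nat.beq s 0 then [] else strict (Nat.log2 s) fun i =>
      match k i with
      | [] => strict (Nat.xor s (bit i)) fun s' => firstSome t s' k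
      | a :: p => a :: p

@[simp] lemma strict_eq {α : Type} (a : ℕ) (k : ℕ → α) : strict a k = k a := by
  cases a <;> rfl

@[simp] lemma testBit_land (s t i : ℕ) : (Nat.land s t).testBit i = (s.testBit i && t.testBit i) :=
  Nat.testBit_and s t i

@[simp] lemma testBit_lor (s t i : ℕ) : (Nat.lor s t).testBit i = (s.testBit i || t.testBit i) :=
  Nat.testBit_or s t i

@[simp] lemma testBit_xor (s t i : ℕ) :
    (Nat.xor s t).testBit i = (s.testBit i ^^ t.testBit i) :=
  Nat.testBit_xor s t i

@[simp] lemma testBit_bit (i j : ℕ) : (bit i).testBit j = decide (i = j) :=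
  Nat.testBit_two_pow

@[simp] lemma mem_eq (s i : ℕ) : mem s i = s.testBit i := by
  rw [Nat.testBit_eq_decide_div_mod_eq, ← Nat.shiftRight_eq_div_pow, ← Nat.and_one_is_mod,
    Bool.eq_iff_iff, decide_eq_true_iff]
  exact iff_of_eq Nat.beq_eq

@[simp] lemma testBit_diff (s t i : ℕ) : (diff s t).testBit i = (s.testBit i && !t.testBit i) := by
  simp only [diff, testBit_xor, testBit_land]
  cases s.testBit i <;> cases t.testBit i <;> rfl

lemma testBit_row (A i j : ℕ) : (row A i).testBit j =
    (decide (j < 16) && A.testBit (16 * i + j)) := by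
  change ((A >>> (16 * i)) % 2 ^ 16).testBit j = _
  rw [Nat.testBit_mod_two_pow, Nat.testBit_shiftRight]

@[simp] lemma beq_eq (s t : ℕ) : Nat.beq s t = decide (s = t) := by
  rw [Bool.eq_iff_iff, decide_eq_true_iff]; exact iff_of_eq Nat.beq_eq


/-! ### Configurations -/

/-- For `m = n`, the configuration that arises from the configuration `A` on `{0, …, n - 1}` by
adding the vertex `n` with the set `s` of neighbours. In general, the symmetric entries `(i, n)`
are only set for `i < m`, where `m` is the last but one argument. -/
def extend (n s : ℕ) : ℕ → ℕ → ℕ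
  | 0, A => Nat.lor A (Nat.shiftLeft s (Nat.mul 16 n))
  | i + 1, A => bif mem s i then
        strict (Nat.lor A (bit (Nat.add (Nat.mul 16 i) n))) fun A' => extend n s i A'
      else extend n s i A

variable {V : Type*} {G : SimpleGraph V} {n A : ℕ} {f : ℕ → V}

/-- The first `n` values of `f` are distinct and induce in `G` the graph encoded by `A`, which has
no edges outside `{0, …, n - 1}`. -/
structure Realizes (G : SimpleGraph V) (n A : ℕ) (f : ℕ → V) : Prop where
  inj : ∀ i < n, ∀ j < n, f i = f j → i = j
  adj : ∀ i < n, ∀ j < n, (row A i).testBit j = true ↔ G.Adj (f i) (f j)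
  lt : ∀ i j, (row A i).testBit j = true → i < n ∧ j < n

lemma testBit_row_extend {s : ℕ} (hn : n < 16) (hs : ∀ j, s.testBit j = true → j < n) (m i j : ℕ)
    (A : ℕ) : (row (extend n s m A) i).testBit j = true ↔
      (row A i).testBit j = true ∨ (i = n ∧ s.testBit j = true) ∨
        (j = n ∧ i < m ∧ s.testBit i = true) := by
  induction m generalizing A with
  | zero =>
    simp only [extend, testBit_row, testBit_lor, not_lt_zero, false_and, and_false, or_false,
      Bool.and_eq_true, Bool.or_eq_true, decide_eq_true_eq]
    have : (Nat.shiftLeft s (Nat.mul 16 n)).testBit (16 * i + j) =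
        (decide (16 * i + j ≥ 16 * n) && s.testBit (16 * i + j - 16 * n)) :=
      Nat.testBit_shiftLeft ..
    rw [this, Bool.and_eq_true, decide_eq_true_eq]
    constructor
    · rintro ⟨hj, h | ⟨h, h'⟩⟩
      · exact .inl ⟨hj, h⟩
      · have := hs _ h'
        obtain rfl : i = n := by omega
        exact .inr ⟨rfl, by simpa using h'⟩
    · rintro (⟨hj, h⟩ | ⟨rfl, h⟩)
      · exact ⟨hj, .inl h⟩
      · exact ⟨(hs _ h).trans hn, .inr ⟨by omega, by simpa using h⟩⟩
  | succ m ih =>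
    rw [extend, mem_eq, strict_eq]
    cases hm : s.testBit m
    · rw [cond_false, ih]
      refine or_congr_right (or_congr_right (and_congr_right fun _ => ?_))
      constructor
      · rintro ⟨h, h'⟩
        exact ⟨by omega, h'⟩
      · rintro ⟨h, h'⟩
        refine ⟨lt_of_le_of_ne (by omega) ?_, h'⟩
        rintro rfl
        simp [hm] at h'
    · rw [cond_true, ih, testBit_row, testBit_row, testBit_lor, testBit_bit]
      simp only [Bool.and_eq_true, Bool.or_eq_true, decide_eq_true_eq]
      -- Columns are below `16`, so the bit of the entry `(m, n)` belongs to no other entry.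
      have key : (j < 16 ∧ Nat.add (Nat.mul 16 m) n = 16 * i + j) ↔ i = m ∧ j = n := by
        change (j < 16 ∧ 16 * m + n = 16 * i + j) ↔ _
        omega
      constructor
      · rintro (⟨hj, h | h⟩ | h | h)
        · exact .inl ⟨hj, h⟩
        · obtain ⟨rfl, rfl⟩ := key.1 ⟨hj, h⟩
          exact .inr (.inr ⟨rfl, by omega, hm⟩)
        · exact .inr (.inl h)
        · exact .inr (.inr ⟨h.1, by omega, h.2.2⟩)
      · rintro (⟨hj, h⟩ | h | ⟨h₁, h₂, h₃⟩)
        · exact .inl ⟨hj, .inl h⟩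
        · exact .inr (.inl h)
        · by_cases him : i = m
          · obtain ⟨hj, h⟩ := key.2 ⟨him, h₁⟩
            exact .inl ⟨hj, .inr h⟩
          · exact .inr (.inr ⟨h₁, by omega, h₃⟩)

lemma lt_of_testBit_row {m i j : ℕ} (hA : A < 2 ^ (16 * m))
    (h : ∀ a < m, ∀ b < 16, A.testBit (16 * a + b) = true → b < m)
    (hij : (row A i).testBit j = true) : i < m ∧ j < m := by
  rw [testBit_row, Bool.and_eq_true, decide_eq_true_eq] at hij
  have hi : i < m := by
    by_contra hi
    rw [Nat.testBit_eq_false_of_lt (hA.trans_le (Nat.pow_le_pow_right two_pos (by omega)))] at hij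
    simp at hij
  exact ⟨hi, h i hi j hij.1 hij.2⟩

lemma Realizes.extend (hf : Realizes G n A f) (hn : n < 16) {x : V} (hx : ∀ i < n, x ≠ f i)
    {s : ℕ} (hs : ∀ j, s.testBit j = true ↔ j < n ∧ G.Adj (f j) x) :
    Realizes G (n + 1) (InducedSearch.extend n s n A) (Function.update f n x) := by
  have hrow := fun i j => testBit_row_extend hn (fun j h => ((hs j).1 h).1) n i j A
  refine ⟨fun i hi j hj h => ?_, fun i hi j hj => ?_, fun i j h => ?_⟩
  · obtain hi | rfl := Nat.lt_succ_iff_lt_or_eq.1 hi <;>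
      obtain hj | rfl := Nat.lt_succ_iff_lt_or_eq.1 hj
    · rw [Function.update_of_ne hi.ne, Function.update_of_ne hj.ne] at h
      exact hf.inj i hi j hj h
    · rw [Function.update_of_ne hi.ne, Function.update_self] at h
      exact absurd h.symm (hx i hi)
    · rw [Function.update_of_ne hj.ne, Function.update_self] at h
      exact absurd h (hx j hj)
    · rfl
  · rw [hrow]
    obtain hi | rfl := Nat.lt_succ_iff_lt_or_eq.1 hi <;>
      obtain hj | rfl := Nat.lt_succ_iff_lt_or_eq.1 hj
    · rw [Function.update_of_ne hi.ne, Function.update_of_ne hj.ne, ← hf.adj i hi j hj]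
      simp [hi.ne, hj.ne]
    · rw [Function.update_of_ne hi.ne, Function.update_self]
      have : ¬ (row A i).testBit j = true := fun h => (hf.lt i j h).2.false
      simp [hi, hi.ne, this, hs]
    · rw [Function.update_of_ne hj.ne, Function.update_self, G.adj_comm]
      have : ¬ (row A i).testBit j = true := fun h => (hf.lt i j h).1.false
      simp [hj, hj.ne, this, hs]
    · have : ¬ (row A j).testBit j = true := fun h => (hf.lt j j h).1.false
      simp [this, hs]
  · rw [hrow] at h
    obtain h | ⟨rfl, h⟩ | ⟨rfl, h, -⟩ := h
    · have := hf.lt i j h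
      omega
    · have := ((hs j).1 h).1
      omega
    · omega

/-! ### Induced paths -/

/-- Backtracking search for an induced path that continues the path `p`, listed from its current end
`v`, by the given number of vertices, all outside of the set `forb`. -/
def growRight (A : ℕ) : ℕ → ℕ → ℕ → List ℕ → List ℕ
  | 0, _, _, p => p
  | l + 1, v, forb, p => strict (row A v) fun r => strict (diff r forb) fun c =>
      strict (Nat.lor forb r) fun forb' => firstSome 16 c fun w => growRight A l w forb' (w :: p)

/-- Backtracking search for an induced path through `x`. The arm `p` that starts at `x` is listed
from its current end `v`; `forb` is the set of vertices that may not continue it, and `nb` is the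
closed neighbourhood of `p` without `x`. The arm is prolonged, and as soon as at most three vertices are
missing, these are also sought on the other side of `x`. -/
def growLeft (A x : ℕ) : ℕ → ℕ → ℕ → ℕ → List ℕ → List ℕ
  | 0, _, _, _, p => p
  | l + 1, v, forb, nb, p =>
      match
        bif Nat.ble l 2 then
          strict (row A x) fun rx => strict (diff rx nb) fun c =>
          strict (Nat.lor (Nat.lor nb rx) (bit x)) fun forb' =>
          firstSome 16 c fun w => growRight A l w forb' (w :: p.reverse)
        else [] with
      | a :: q => a :: q
      | [] =>
          strict (row A v) fun r => strict (diff r forb) fun c =>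
          strict (Nat.lor forb r) fun forb' =>
          firstSome 16 c fun w => strict (Nat.lor nb (Nat.lor (row A w) (bit w))) fun nb' =>
          growLeft A x l w forb' nb' (w :: p)

/-- Whether the vertices of the list continue an induced path with vertex set `M` and last vertex
`l` to a longer induced path. -/
def isInducedPathFrom (A : ℕ) : List ℕ → ℕ → ℕ → Bool
  | [], _, _ => true
  | a :: p, l, M => Nat.beq (Nat.land (row A a) M) (bit l) && !(mem M a) &&
      strict (Nat.lor M (bit a)) fun M' => isInducedPathFrom A p a M'

/-- Whether the backtracking search finds an induced path through `x` with `l + 1` vertices; the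
path found is checked. -/
def hasPath (l A x : ℕ) : Bool :=
  match growLeft A x l x (bit x) 0 [x] with
  | [] => false
  | a :: p => Nat.beq p.length l && isInducedPathFrom A p a (bit a)

/-- Consecutive elements of the list, and no others, are related by `r`, and the elements are
distinct. Only pairs in the order of the list are considered. -/
def IsInducedList (r : ℕ → ℕ → Prop) : List ℕ → Prop
  | a :: b :: p => r a b ∧ a ≠ b ∧ (∀ c ∈ p, a ≠ c ∧ ¬ r a c) ∧ IsInducedList r (b :: p)
  | _ => True

lemma IsInducedList.getElem {r : ℕ → ℕ → Prop} : ∀ {p : List ℕ}, IsInducedList r p →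
    ∀ i j (hij : i < j) (hj : j < p.length), p[i] ≠ p[j] ∧ (r p[i] p[j] ↔ i + 1 = j)
  | [], _, _, _, _, hj => by simp at hj
  | [_], _, _, _, _, hj => by simp at hj; omega
  | a :: b :: p, ⟨hab, hne, hp, ih⟩, i, j, hij, hj => by
    obtain _ | j := j
    · omega
    obtain _ | i := i
    · obtain _ | j := j
      · exact ⟨hne, by simpa using hab⟩
      · have := hp (p[j]'(by simpa using hj)) (List.getElem_mem _)
        simpa using this
    · have := ih.getElem i j (by omega) (by simpa using hj)
      simpa using this

lemma isInducedList_of_isInducedPathFrom : ∀ (p q : List ℕ) (a M : ℕ),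
    IsInducedList (fun i j => (row A i).testBit j = true) (a :: q) →
    (a :: q).Nodup → (∀ j, M.testBit j = true ↔ j ∈ a :: q) → isInducedPathFrom A p a M = true →
    ∃ p', p'.length = p.length + q.length + 1 ∧
      IsInducedList (fun i j => (row A i).testBit j = true) p'
  | [], q, a, M, hq, _, hM, _ => ⟨a :: q, by simp, hq⟩
  | b :: p, q, a, M, hq, hnd, hM, h => by
    simp only [isInducedPathFrom, beq_eq, mem_eq, strict_eq, Bool.and_eq_true, decide_eq_true_eq,
      Bool.not_eq_true'] at h
    obtain ⟨⟨hrow, hb⟩, h⟩ := h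
    have hbit (j : ℕ) (hj : j ∈ a :: q) : (row A b).testBit j = true ↔ a = j := by
      have := congrArg (Nat.testBit · j) hrow
      simp only [testBit_land, (hM j).2 hj, Bool.and_true, testBit_bit] at this
      rw [this, decide_eq_true_iff]
    have hb' : b ∉ a :: q := by rw [← hM, hb]; simp
    have haq : a ∉ q := (List.nodup_cons.1 hnd).1
    obtain ⟨p', hlen, hp'⟩ := isInducedList_of_isInducedPathFrom p (a :: q) b _
      ⟨(hbit a (by simp)).2 rfl, fun h => hb' (by simp [h]), fun c hc =>
        ⟨fun h => hb' (by simp [h, hc]), fun h => haq ((hbit c (by simp [hc])).1 h ▸ hc)⟩, hq⟩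
      (List.nodup_cons.2 ⟨hb', hnd⟩)
      (fun j => by
        simp only [testBit_lor, Bool.or_eq_true, hM, testBit_bit, decide_eq_true_eq]
        simp only [List.mem_cons]; tauto) h
    exact ⟨p', by simpa [add_assoc, add_comm, add_left_comm] using hlen, hp'⟩

lemma Realizes.pathGraph_isIndContained (hf : Realizes G n A f) {p : List ℕ} {l : ℕ}
    (hl : 1 ≤ l) (hlen : p.length = l + 1)
    (hp : IsInducedList (fun i j => (row A i).testBit j = true) p) :
    (SimpleGraph.pathGraph (l + 1)).IsIndContained G := by
  have hget := hp.getElem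
  have hlt (i : ℕ) (hi : i < p.length) : p[i] < n := by
    obtain _ | i := i
    · exact (hf.lt _ _ ((hget 0 1 one_pos (by omega)).2.2 rfl)).1
    · exact (hf.lt _ _ ((hget i (i + 1) i.lt_succ_self hi).2.2 rfl)).2
  have hadj (i j : ℕ) (hij : i < j) (hj : j < p.length) :
      G.Adj (f p[i]) (f p[j]) ↔ i + 1 = j := by
    rw [← hf.adj _ (hlt i _) _ (hlt j _), (hget i j hij hj).2]
  refine ⟨⟨⟨fun i => f (p[i.1]'(by omega)), fun i j h => ?_⟩, fun {i j} => ?_⟩⟩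
  · have h := hf.inj _ (hlt _ _) _ (hlt _ _) h
    by_contra hij
    obtain hij | hij := lt_or_gt_of_ne (Fin.val_ne_of_ne hij)
    · exact (hget _ _ hij (by omega)).1 h
    · exact (hget _ _ hij (by omega)).1 h.symm
  · change G.Adj (f p[i.1]) (f p[j.1]) ↔ _
    rw [SimpleGraph.pathGraph_adj]
    obtain hij | hij | hij := lt_trichotomy i.1 j.1
    · rw [hadj _ _ hij]
      omega
    · simp [hij]
    · rw [G.adj_comm, hadj _ _ hij]
      omega

lemma Realizes.pathGraph_isIndContained_of_hasPath (hf : Realizes G n A f) {l x : ℕ} (hl : 1 ≤ l)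
    (h : hasPath l A x = true) : (SimpleGraph.pathGraph (l + 1)).IsIndContained G := by
  unfold hasPath at h
  split at h
  · simp at h
  · rename_i a p _
    simp only [beq_eq, Bool.and_eq_true, decide_eq_true_eq] at h
    obtain ⟨p', hlen, hp'⟩ := isInducedList_of_isInducedPathFrom p [] a (bit a) trivial
      (List.nodup_singleton a) (by simp [eq_comm]) h.2
    exact hf.pathGraph_isIndContained hl (by rw [hlen, h.1]; rfl) hp'

/-! ### Neighbourhoods of further vertices -/

/-- The local properties of a counterexample: distinct nonadjacent vertices have at most one common
neighbour, all degrees are at least three, and no neighbourhood is a clique. The last property is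
stated in the equivalent form in which the search uses it. -/
structure Admissible (G : SimpleGraph V) : Prop where
  eq_of_adj : ∀ a b x y, a ≠ b → ¬ G.Adj a b → G.Adj a x → G.Adj b x → G.Adj a y → G.Adj b y → x = y
  exists_ne : ∀ v a b, ∃ x, G.Adj v x ∧ x ≠ a ∧ x ≠ b
  exists_not_adj : ∀ v c, G.Adj v c → ∃ x, G.Adj v x ∧ x ≠ c ∧ ¬ G.Adj c x

/-- The union of `acc` and of the neighbourhoods of the elements of the bit set `s`. -/
def rowUnion (A : ℕ) : ℕ → ℕ → ℕ → ℕ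
  | 0, _, acc => acc
  | t + 1, s, acc => bif Nat.beq s 0 then acc else
      strict (Nat.log2 s) fun i => strict (Nat.xor s (bit i)) fun s' =>
      strict (Nat.lor acc (row A i)) fun acc' => rowUnion A t s' acc'

/-- The vertices that are different from `i` and not adjacent to `i`, but have a common
neighbour with `i`. A further vertex
adjacent to `i` is adjacent to none of them. -/
def far (A i : ℕ) : ℕ := strict (row A i) fun r => diff (rowUnion A 16 r 0) (Nat.lor r (bit i))

/-- Whether `leaf` holds for all sets that consist of `s` and of elements of `a`, where the choice
of an element `i` excludes the vertices in `far A i`. The first numerical argument bounds the size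
of `a`. -/
def allNbrSets (A : ℕ) (leaf : ℕ → Bool) : ℕ → ℕ → ℕ → Bool
  | 0, _, _ => false
  | t + 1, s, a => bif Nat.beq a 0 then leaf s else
      strict (Nat.log2 a) fun i => strict (Nat.xor a (bit i)) fun a' => allNbrSets A leaf t s a' &&
        strict (Nat.lor s (bit i)) fun s' => strict (diff a' (far A i)) fun a'' =>
        allNbrSets A leaf t s' a''

/-- Looks for adjacent vertices `i ∈ m` and `j ∈ s` that have a common neighbour outside `s`. For
`m = s`, a further vertex with the set `s` of neighbours would then complete a diamond. -/
def splitsTriangle (A s : ℕ) : ℕ → ℕ → Bool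
  | 0, _ => false
  | t + 1, m => bif Nat.beq m 0 then false else
      strict (Nat.log2 m) fun i => strict (Nat.land (row A i) s) fun r =>
      bif Nat.beq r 0 || Nat.beq (diff (Nat.land (row A i) (row A (Nat.log2 r))) s) 0 then
        strict (Nat.xor m (bit i)) fun m' => splitsTriangle A s t m'
      else true

lemma exists_testBit_of_rowUnion : ∀ (t s acc j : ℕ), (rowUnion A t s acc).testBit j = true →
    acc.testBit j = true ∨ ∃ k, s.testBit k = true ∧ (row A k).testBit j = true
  | 0, _, _, _, h => .inl h
  | t + 1, s, acc, j, h => by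
    rw [rowUnion, beq_eq] at h
    by_cases hs : s = 0
    · simp only [hs, decide_true, cond_true] at h
      exact .inl h
    · simp only [hs, decide_false, cond_false, strict_eq] at h
      obtain h | ⟨k, hk, h⟩ := exists_testBit_of_rowUnion t _ _ j h
      · rw [testBit_lor, Bool.or_eq_true] at h
        exact h.imp_right fun h => ⟨_, Nat.testBit_log2 hs, h⟩
      · refine .inr ⟨k, ?_, h⟩
        by_contra hk'
        by_cases hsk : Nat.log2 s = k
        · exact hk' (hsk ▸ Nat.testBit_log2 hs)
        · simp [hsk, hk'] at hk

lemma testBit_xor_log2 {s : ℕ} (hs : s ≠ 0) (j : ℕ) :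
    (Nat.xor s (bit (Nat.log2 s))).testBit j = true ↔ s.testBit j = true ∧ j ≠ Nat.log2 s := by
  rw [testBit_xor, testBit_bit]
  by_cases hj : Nat.log2 s = j
  · simp [← hj, Nat.testBit_log2 hs]
  · simp [hj, Ne.symm hj]

lemma Realizes.exists_of_testBit_far (hf : Realizes G n A f) {i j : ℕ}
    (h : (far A i).testBit j = true) :
    f i ≠ f j ∧ ¬ G.Adj (f i) (f j) ∧ ∃ k < n, G.Adj (f i) (f k) ∧ G.Adj (f j) (f k) := by
  simp only [far, strict_eq, testBit_diff, testBit_lor, testBit_bit, Bool.and_eq_true,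
    Bool.not_eq_true', Bool.or_eq_false_iff, decide_eq_false_iff_not] at h
  obtain ⟨h, hij, hne⟩ := h
  obtain h | ⟨k, hik, hkj⟩ := exists_testBit_of_rowUnion _ _ _ _ h
  · simp at h
  · obtain ⟨hi, hk⟩ := hf.lt _ _ hik
    obtain ⟨-, hj⟩ := hf.lt _ _ hkj
    exact ⟨fun h => hne (hf.inj i hi j hj h), by rw [← hf.adj i hi j hj, hij]; simp, k, hk,
      (hf.adj i hi k hk).1 hik, ((hf.adj k hk j hj).1 hkj).symm⟩

/-- The enumeration misses no admissible neighbourhood of a vertex `x` outside the configuration: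
two of its neighbours at distance two in the configuration would have `x` as a second common
neighbour. -/
lemma exists_of_allNbrSets (hG : Admissible G) (hf : Realizes G n A f) {x : V}
    (hx : ∀ i < n, x ≠ f i) {leaf : ℕ → Bool} : ∀ t s a, allNbrSets A leaf t s a = true →
    (∀ j, s.testBit j = true → j < n ∧ G.Adj (f j) x) → (∀ j, a.testBit j = true → j < n) →
    (∀ j < n, G.Adj (f j) x → s.testBit j = true ∨ a.testBit j = true) →
    ∃ s, leaf s = true ∧ ∀ j, s.testBit j = true ↔ j < n ∧ G.Adj (f j) x
  | 0, _, _, h, _, _, _ => by simp [allNbrSets] at h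
  | t + 1, s, a, h, hs, ha, hsa => by
    rw [allNbrSets, beq_eq] at h
    by_cases ha0 : a = 0
    · simp only [ha0, decide_true, cond_true] at h
      refine ⟨s, h, fun j => ⟨hs j, fun hj => ?_⟩⟩
      simpa [ha0] using hsa j hj.1 hj.2
    simp only [ha0, decide_false, cond_false, strict_eq, Bool.and_eq_true] at h
    have hai := Nat.testBit_log2 ha0
    have hxor := testBit_xor_log2 ha0
    set i := Nat.log2 a
    by_cases hi : G.Adj (f i) x
    · refine exists_of_allNbrSets hG hf hx t _ _ h.2 (fun j hj => ?_) (fun j hj => ?_)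
        fun j hj hjx => ?_
      · rw [testBit_lor, testBit_bit, Bool.or_eq_true, decide_eq_true_eq] at hj
        obtain hj | rfl := hj
        · exact hs j hj
        · exact ⟨ha _ hai, hi⟩
      · rw [testBit_diff, Bool.and_eq_true, hxor] at hj
        exact ha j hj.1.1
      · rw [testBit_lor, testBit_bit, testBit_diff, Bool.or_eq_true, Bool.and_eq_true, hxor,
          decide_eq_true_eq]
        by_cases hij : i = j
        · exact .inl (.inr hij)
        · refine (hsa j hj hjx).imp .inl fun h => ⟨⟨h, Ne.symm hij⟩, ?_⟩
          rw [Bool.not_eq_true', ← Bool.not_eq_true]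
          intro hfar
          obtain ⟨hne, hadj, k, hk, hik, hjk⟩ := hf.exists_of_testBit_far hfar
          exact hx k hk (hG.eq_of_adj _ _ _ _ hne hadj hi hjx hik hjk)
    · refine exists_of_allNbrSets hG hf hx t _ _ h.1 hs (fun j hj => ha j ((hxor j).1 hj).1)
        fun j hj hjx => (hsa j hj hjx).imp_right fun h => (hxor j).2 ⟨h, ?_⟩
      rintro rfl
      exact hi hjx

/-- A vertex `k` of the configuration that is not adjacent to `x` has at most one common neighbour
with `x`. -/
lemma splitsTriangle_eq_false (hG : Admissible G) (hf : Realizes G n A f) {x : V}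
    (hx : ∀ i < n, x ≠ f i) {s : ℕ} (hs : ∀ j, s.testBit j = true ↔ j < n ∧ G.Adj (f j) x) :
    ∀ t m, (∀ j, m.testBit j = true → s.testBit j = true) → splitsTriangle A s t m = false
  | 0, _, _ => rfl
  | t + 1, m, hm => by
    rw [splitsTriangle, beq_eq]
    by_cases hm0 : m = 0
    · simp [hm0]
    simp only [hm0, decide_false, cond_false, strict_eq, beq_eq]
    have hi := hm _ (Nat.testBit_log2 hm0)
    have hxor := testBit_xor_log2 hm0
    set i := Nat.log2 m
    have key : (decide (Nat.land (row A i) s = 0) || decide (diff (Nat.land (row A i)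
        (row A (Nat.land (row A i) s).log2)) s = 0)) = true := by
      rw [Bool.or_eq_true, decide_eq_true_eq, decide_eq_true_eq, or_iff_not_imp_left]
      intro hr
      have hj := Nat.testBit_log2 hr
      set j := (Nat.land (row A i) s).log2
      rw [testBit_land, Bool.and_eq_true] at hj
      obtain ⟨hij, hjs⟩ := hj
      refine Nat.eq_of_testBit_eq fun k => ?_
      rw [Nat.zero_testBit, ← Bool.not_eq_true]
      simp only [testBit_diff, testBit_land, Bool.and_eq_true, Bool.not_eq_true']
      rintro ⟨⟨hik, hjk⟩, hks⟩
      obtain ⟨hin, hix⟩ := (hs i).1 hi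
      obtain ⟨hjn, hjx⟩ := (hs j).1 hjs
      have hkn := (hf.lt _ _ hik).2
      have hkx : ¬ G.Adj (f k) x := fun h => by simp [(hs k).2 ⟨hkn, h⟩] at hks
      have := hG.eq_of_adj (f k) x (f i) (f j) (hx k hkn).symm hkx
        ((hf.adj _ hin _ hkn).1 hik).symm hix.symm ((hf.adj _ hjn _ hkn).1 hjk).symm hjx.symm
      exact ((hf.adj _ hin _ hjn).1 hij).ne this
    rw [key, cond_true]
    exact splitsTriangle_eq_false hG hf hx hs t _ fun j hj => hm j ((hxor j).1 hj).1

/-! ### The search -/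

/-- Whether `test` holds for all configurations that arise from `A` by adding a vertex adjacent to
`v` and to no element of `ex`, apart from those that contain one of the forbidden patterns. -/
def allExtensions (l A n v ex : ℕ) (test : ℕ → Bool) : Bool :=
  strict (diff (diff (diff (Nat.sub (bit n) 1) (bit v)) (far A v)) ex) fun a =>
    allNbrSets A (fun s => splitsTriangle A s 16 s ||
      strict (extend n s n A) fun A' => hasPath l A' n || test A') 16 (bit v) a

/-- Calls `k v ex` for the newest vertex `v` that must have a neighbour outside the configuration
`A`, which can be chosen nonadjacent to the elements of `ex`. These are the vertices whose
neighbours in `A` form a clique (`ex` contains one of them, if there is any) or are two in number.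
If there is no such vertex, the result is `stuck`. -/
def expandNewest (A n : ℕ) (stuck : Bool) (k : ℕ → ℕ → Bool) : ℕ → Bool
  | 0 => stuck
  | v + 1 => strict (row A v) fun r =>
      bif Nat.beq r 0 then k v 0 else
        strict (Nat.log2 r) fun c => strict (Nat.xor r (bit c)) fun q =>
        bif Nat.beq (diff q (row A c)) 0 then k v (bit c) else
        bif Nat.beq q (bit (Nat.log2 q)) then k v 0 else expandNewest A n stuck k v

/-- The Petersen graph as a configuration, with the vertices in the order of `kneser`. -/
def petersenCode : ℕ := 1962522746341454904494961254200583600345251854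

/-- The elements `w` of `c` such that mapping `a` to `w` extends the partial embedding `p` of the
Petersen graph. The list `p` holds the images of the vertices below `a` in descending order. -/
def compatible (A a : ℕ) : List ℕ → ℕ → ℕ
  | [], c => c
  | w :: p, c => compatible A a p <|
      bif mem (row petersenCode a) p.length then Nat.land c (row A w)
      else diff c (Nat.lor (row A w) (bit w))

/-- Backtracking search for an induced Petersen graph in the configuration `A`, with `p` as in
`compatible`. -/
def labelling (A n : ℕ) : ℕ → ℕ → List ℕ → List ℕ
  | 0, _, p => p
  | t + 1, a, p => firstSome 16 (compatible A a p (Nat.sub (bit n) 1)) fun w =>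
      labelling A n t (a + 1) (w :: p)

/-- Whether the list `q` embeds the Petersen graph into `A` as an induced subgraph. -/
def isLabelling (A n : ℕ) (q : List ℕ) : Bool :=
  (List.range 10).all fun a => decide (q.getD a 0 < n) && (List.range 10).all fun b =>
    (Nat.beq a b || !(Nat.beq (q.getD a 0) (q.getD b 0))) &&
      (mem (row A (q.getD a 0)) (q.getD b 0) == mem (row petersenCode a) b)

/-- Whether the backtracking search finds an induced Petersen graph in the configuration `A`. -/
def isPetersen (A n : ℕ) : Bool := isLabelling A n (labelling A n 10 0 []).reverse

/-- The exhaustive search from the configuration `A` on `n` vertices in graphs without induced paths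
on `l + 1` vertices, with the first numerical argument after `final` as a bound for the depth. It
succeeds if all branches die or end in a configuration that satisfies `final` and does not force
further vertices. -/
def search (l : ℕ) (final : ℕ → ℕ → Bool) : ℕ → ℕ → ℕ → Bool
  | 0, _, _ => false
  | t + 1, n, A => expandNewest A n (final A n)
      (fun v ex => allExtensions l A n v ex fun A' => search l final t n.succ A') n

lemma exists_of_allExtensions (hG : Admissible G) (hf : Realizes G n A f) {l : ℕ} (hl : 1 ≤ l)
    (hpath : ¬ (SimpleGraph.pathGraph (l + 1)).IsIndContained G) (hn : n < 16) {v ex : ℕ} {x : V}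
    (hv : v < n) (hx : ∀ i < n, x ≠ f i) (hvx : G.Adj (f v) x)
    (hex : ∀ j < n, ex.testBit j = true → ¬ G.Adj (f j) x) {test : ℕ → Bool}
    (h : allExtensions l A n v ex test = true) :
    ∃ A' g, test A' = true ∧ Realizes G (n + 1) A' g := by
  have hbits (j : ℕ) : (Nat.sub (bit n) 1).testBit j = decide (j < n) :=
    Nat.testBit_two_pow_sub_one ..
  rw [allExtensions, strict_eq] at h
  obtain ⟨s, h, hs⟩ := exists_of_allNbrSets hG hf hx _ _ _ h
    (fun j hj => by
      rw [testBit_bit, decide_eq_true_eq] at hj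
      exact hj ▸ ⟨hv, hvx⟩)
    (fun j hj => by
      simp only [testBit_diff, hbits, Bool.and_eq_true, decide_eq_true_eq] at hj
      exact hj.1.1.1)
    (fun j hj hjx => by
      by_cases hvj : v = j
      · simp [hvj]
      right
      simp only [testBit_diff, hbits, testBit_bit, hj, hvj, decide_true, decide_false,
        Bool.and_eq_true, Bool.not_eq_true', Bool.not_false, true_and, ← Bool.not_eq_true]
      refine ⟨fun hfar => ?_, fun h => hex j hj h hjx⟩
      obtain ⟨hne, hadj, k, hk, hik, hjk⟩ := hf.exists_of_testBit_far hfar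
      exact hx k hk (hG.eq_of_adj _ _ _ _ hne hadj hvx hjx hik hjk))
  have hf' := hf.extend hn hx hs
  rw [splitsTriangle_eq_false hG hf hx hs 16 s fun _ => id, Bool.false_or, strict_eq,
    Bool.or_eq_true] at h
  exact ⟨_, _, h.resolve_left fun h => hpath (hf'.pathGraph_isIndContained_of_hasPath hl h), hf'⟩

lemma exists_of_expandNewest (hG : Admissible G) (hf : Realizes G n A f) {stuck : Bool}
    {k : ℕ → ℕ → Bool} :
    ∀ m ≤ n, expandNewest A n stuck k m = true → stuck = true ∨ ∃ v < n, ∃ ex x, k v ex = true ∧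
      (∀ i < n, x ≠ f i) ∧ G.Adj (f v) x ∧ ∀ j < n, ex.testBit j = true → ¬ G.Adj (f j) x
  | 0, _, h => .inl h
  | v + 1, hv, h => by
    have hrow (i : ℕ) (hi : i < n) (h : G.Adj (f v) (f i)) : (row A v).testBit i = true :=
      (hf.adj v hv i hi).2 h
    simp only [expandNewest, strict_eq, beq_eq] at h
    by_cases hr : row A v = 0
    · simp only [hr, decide_true, cond_true] at h
      obtain ⟨x, hvx, -⟩ := hG.exists_ne (f v) (f v) (f v)
      refine .inr ⟨v, hv, 0, x, h, ?_, hvx, by simp⟩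
      rintro i hi rfl
      simpa [hr] using hrow i hi hvx
    simp only [hr, decide_false, cond_false] at h
    have hc := Nat.testBit_log2 hr
    have hxor := testBit_xor_log2 hr
    -- `c` is one of the neighbours of `v` in the configuration, and `q` is the set of the others.
    set c := (row A v).log2
    set q := Nat.xor (row A v) (bit c)
    have hcn := (hf.lt _ _ hc).2
    have hvc := (hf.adj v hv c hcn).1 hc
    by_cases hq : diff q (row A c) = 0
    · simp only [hq, decide_true, cond_true] at h
      obtain ⟨x, hvx, hxc, hcx⟩ := hG.exists_not_adj (f v) (f c) hvc
      refine .inr ⟨v, hv, bit c, x, h, ?_, hvx, ?_⟩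
      · rintro i hi rfl
        have h1 : q.testBit i = true := (hxor i).2 ⟨hrow i hi hvx, fun h => hxc (h ▸ rfl)⟩
        have h2 : ¬ (row A c).testBit i = true := fun h => hcx ((hf.adj c hcn i hi).1 h)
        have := congrArg (Nat.testBit · i) hq
        simp [h1, h2] at this
      · intro j _ hj
        rw [testBit_bit, decide_eq_true_eq] at hj
        exact hj ▸ hcx
    simp only [hq, decide_false, cond_false] at h
    by_cases hq2 : q = bit q.log2
    · rw [decide_eq_true hq2, cond_true] at h
      obtain ⟨x, hvx, hxc, hxd⟩ := hG.exists_ne (f v) (f c) (f q.log2)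
      refine .inr ⟨v, hv, 0, x, h, ?_, hvx, by simp⟩
      rintro i hi rfl
      have h1 : q.testBit i = true := (hxor i).2 ⟨hrow i hi hvx, fun h => hxc (h ▸ rfl)⟩
      rw [hq2, testBit_bit, decide_eq_true_eq] at h1
      exact hxd (h1 ▸ rfl)
    · rw [decide_eq_false hq2, cond_false] at h
      exact exists_of_expandNewest hG hf v (Nat.le_of_succ_le hv) h

lemma exists_realizes_petersenCode_of_isLabelling (hf : Realizes G n A f) {q : List ℕ}
    (h : isLabelling A n q = true) : ∃ g, Realizes G 10 petersenCode g := by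
  simp only [isLabelling, List.all_eq_true, List.mem_range, beq_eq, mem_eq, Bool.and_eq_true,
    Bool.or_eq_true, Bool.not_eq_true', decide_eq_true_eq, decide_eq_false_iff_not,
    beq_iff_eq] at h
  refine ⟨fun a => f (q.getD a 0), fun a ha b hb hab => ?_, fun a ha b hb => ?_, fun a b hab => ?_⟩
  · exact (((h a ha).2 b hb).1).resolve_right fun hne => hne (hf.inj _ (h a ha).1 _ (h b hb).1 hab)
  · rw [← hf.adj _ (h a ha).1 _ (h b hb).1, ((h a ha).2 b hb).2]
  · exact lt_of_testBit_row (m := 10) (by decide) (by decide) hab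

theorem exists_final_of_search (hG : Admissible G) {l : ℕ} (hl : 1 ≤ l)
    (hpath : ¬ (SimpleGraph.pathGraph (l + 1)).IsIndContained G) {final : ℕ → ℕ → Bool} :
    ∀ (t n A : ℕ) (f : ℕ → V), n + t ≤ 16 → Realizes G n A f → search l final t n A = true →
    ∃ n A f, Realizes G n A f ∧ final A n = true
  | 0, _, _, _, _, _, h => by simp [search] at h
  | t + 1, n, A, f, hn, hf, h => by
    rw [search] at h
    obtain h | ⟨v, hv, ex, x, h, hx, hvx, hex⟩ := exists_of_expandNewest hG hf n le_rfl h
    · exact ⟨n, A, f, hf, h⟩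
    · obtain ⟨A', g, h, hg⟩ := exists_of_allExtensions hG hf hl hpath (by omega) hv hx hvx hex h
      exact exists_final_of_search hG hl hpath t _ A' g (by omega) hg h

/-! ### Computations -/

/-- The path on six vertices as a configuration. -/
def pathSixCode : ℕ := 19343550989226557661577218

set_option maxRecDepth 4000 in
/-- Under `P₇`-freeness, no branch that starts from an induced `P₆` survives. -/
lemma search_pathSixCode : search 6 (fun _ _ => false) 8 6 pathSixCode = true := by decide +kernel

set_option maxRecDepth 4000 in
/-- Under `P₆`-freeness, all surviving branches that start from a vertex end in the Petersen
graph. -/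
lemma search_singleton : search 5 isPetersen 13 1 0 = true := by decide +kernel

set_option maxRecDepth 4000 in
/-- A further vertex adjacent to a vertex of the Petersen graph would complete an induced `P₆`, a
`C₄` or a diamond. -/
lemma allExtensions_petersenCode :
    ((List.range 10).all fun v => allExtensions 5 petersenCode 10 v 0 fun _ => false) = true := by
  decide +kernel

/-! ### Connected admissible graphs -/

lemma realizes_pathSixCode (e : SimpleGraph.pathGraph 6 ↪g G) :
    Realizes G 6 pathSixCode fun i => e (Fin.ofNat 6 i) := by
  have h : ∀ i < 6, ∀ j < 6, (row pathSixCode i).testBit j = true ↔ i + 1 = j ∨ j + 1 = i := by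
    decide +kernel
  refine ⟨fun i hi j hj hij => ?_, fun i hi j hj => ?_, fun i j hij => ?_⟩
  · simpa [Nat.mod_eq_of_lt hi, Nat.mod_eq_of_lt hj] using congrArg Fin.val (e.injective hij)
  · rw [e.map_adj_iff, SimpleGraph.pathGraph_adj, h i hi j hj]
    simp [Nat.mod_eq_of_lt hi, Nat.mod_eq_of_lt hj]
  · exact lt_of_testBit_row (m := 6) (by decide) (by decide) hij

lemma realizes_singleton (v : V) : Realizes G 1 0 fun _ => v :=
  ⟨fun i hi j hj _ => by omega, fun i _ j _ => by simp [testBit_row],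
    fun i j h => by simp [testBit_row] at h⟩

/-- An enumeration of the vertices of the Petersen graph in which each one after the first has an
earlier neighbour, which keeps the search for labellings short. -/
def kneser : Fin 10 → {s : Finset (Fin 5) // s.card = 2} :=
  ![⟨{0, 1}, rfl⟩, ⟨{2, 3}, rfl⟩, ⟨{2, 4}, rfl⟩, ⟨{3, 4}, rfl⟩, ⟨{0, 4}, rfl⟩, ⟨{1, 4}, rfl⟩,
    ⟨{0, 3}, rfl⟩, ⟨{1, 3}, rfl⟩, ⟨{0, 2}, rfl⟩, ⟨{1, 2}, rfl⟩]

lemma kneser_bijective : Function.Bijective kneser := by decide +kernel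

lemma petersenGraph_adj_kneser (i j : Fin 10) :
    petersenGraph.Adj (kneser i) (kneser j) ↔ (row petersenCode i).testBit j = true := by
  change Disjoint (kneser i).1 (kneser j).1 ↔ _
  revert i j
  decide +kernel

/-- An induced Petersen graph is closed under adjacency by `allExtensions_petersenCode`, hence all
of the connected graph `G`. -/
lemma nonempty_iso_petersenGraph_of_realizes (hG : Admissible G) (hconn : G.Connected)
    (hP6 : ¬ (SimpleGraph.pathGraph 6).IsIndContained G) {g : ℕ → V}
    (hg : Realizes G 10 petersenCode g) : Nonempty (G ≃g petersenGraph) := by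
  have hclosed (x y : V) (hx : ∃ i < 10, g i = x) (hxy : G.Adj x y) : ∃ i < 10, g i = y := by
    by_contra! hy
    obtain ⟨v, hv, rfl⟩ := hx
    have h := List.all_eq_true.1 allExtensions_petersenCode v (List.mem_range.2 hv)
    obtain ⟨_, _, h, -⟩ := exists_of_allExtensions hG hg (l := 5) (by norm_num) hP6 (by norm_num) hv
      (fun i hi => (hy i hi).symm) hxy (by simp) h
    simp at h
  have hsurj (x : V) : ∃ i < 10, g i = x := by
    obtain ⟨p⟩ := hconn.preconnected (g 0) x
    have : ∀ (u w : V) (_ : G.Walk u w), (∃ i < 10, g i = u) → ∃ i < 10, g i = w := by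
      intro u w p
      induction p with
      | nil => exact id
      | cons h _ ih => exact fun hu => ih (hclosed _ _ hu h)
    exact this _ _ p ⟨0, by norm_num, rfl⟩
  have hbij : Function.Bijective fun i : Fin 10 => g i :=
    ⟨fun i j h => Fin.ext (hg.inj i i.2 j j.2 h), fun x =>
      let ⟨i, hi, h⟩ := hsurj x
      ⟨⟨i, hi⟩, h⟩⟩
  refine ⟨SimpleGraph.Iso.symm ⟨(Equiv.ofBijective _ kneser_bijective).symm.trans
    (Equiv.ofBijective _ hbij), fun {s t} => ?_⟩⟩
  obtain ⟨i, rfl⟩ := kneser_bijective.surjective s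
  obtain ⟨j, rfl⟩ := kneser_bijective.surjective t
  rw [petersenGraph_adj_kneser, hg.adj i i.2 j j.2]
  have (i : Fin 10) : ((Equiv.ofBijective _ kneser_bijective).symm.trans
      (Equiv.ofBijective _ hbij)) (kneser i) = g i := by
    simp [Equiv.ofBijective_symm_apply_apply]
  simp only [this]

theorem Admissible.nonempty_iso_petersenGraph (hG : Admissible G) (hconn : G.Connected)
    (hP7 : ¬ (SimpleGraph.pathGraph 7).IsIndContained G) : Nonempty (G ≃g petersenGraph) := by
  have hP6 : ¬ (SimpleGraph.pathGraph 6).IsIndContained G := fun ⟨e⟩ => by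
    obtain ⟨_, _, _, _, h⟩ := exists_final_of_search hG (by norm_num) hP7 8 6 _ _ (by norm_num)
      (realizes_pathSixCode e) search_pathSixCode
    simp at h
  obtain ⟨v⟩ := hconn.nonempty
  obtain ⟨_, _, _, hf, h⟩ := exists_final_of_search hG (by norm_num) hP6 13 1 _ _ (by norm_num)
    (realizes_singleton v) search_singleton
  obtain ⟨g, hg⟩ := exists_realizes_petersenCode_of_isLabelling hf h
  exact nonempty_iso_petersenGraph_of_realizes hG hconn hP6 hg

/-! ### Reduction to admissible graphs -/

lemma eq_of_adj_of_adj (hC4 : ¬ (SimpleGraph.cycleGraph 4).IsIndContained G)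
    (hdiamond : ¬ diamondGraph.IsIndContained G) {a b x y : V} (hne : a ≠ b)
    (hab : ¬ G.Adj a b) (hax : G.Adj a x) (hbx : G.Adj b x) (hay : G.Adj a y) (hby : G.Adj b y) :
    x = y := by
  by_contra hxy
  have inj (p q r s : V) (h1 : p ≠ q) (h2 : p ≠ r) (h3 : p ≠ s) (h4 : q ≠ r) (h5 : q ≠ s)
      (h6 : r ≠ s) : Function.Injective ![p, q, r, s] := by
    intro i j h
    fin_cases i <;> fin_cases j <;> simp_all
  by_cases hadj : G.Adj x y
  · refine hdiamond ⟨⟨⟨![a, b, x, y], inj _ _ _ _ hne hax.ne hay.ne hbx.ne hby.ne hxy⟩, ?_⟩⟩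
    intro i j
    fin_cases i <;> fin_cases j <;>
      simp [diamondGraph, hab, hax, hbx, hay, hby, hadj, G.adj_comm b a, hax.symm, hbx.symm,
        hay.symm, hby.symm, hadj.symm]
  · refine hC4 ⟨⟨⟨![a, x, b, y], inj _ _ _ _ hax.ne hne hay.ne hbx.ne.symm hxy hby.ne⟩, ?_⟩⟩
    intro i j
    fin_cases i <;> fin_cases j <;>
      simp [SimpleGraph.cycleGraph_adj, hab, hax, hbx, hay, hby, hadj, G.adj_comm b a, hax.symm,
        hbx.symm, hay.symm, hby.symm, G.adj_comm y x] <;> decide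

lemma exists_adj_ne_ne [Fintype V] [DecidableRel G.Adj] (h : 3 ≤ G.minDegree) (v a b : V) :
    ∃ x, G.Adj v x ∧ x ≠ a ∧ x ≠ b := by
  classical
  have : ({a, b} : Finset V).card < (G.neighborFinset v).card := by
    rw [G.card_neighborFinset_eq_degree]
    exact (Finset.card_le_two.trans_lt (by norm_num)).trans_le (h.trans (G.minDegree_le_degree v))
  obtain ⟨x, hx, hx'⟩ := Finset.exists_mem_notMem_of_card_lt_card this
  simp only [Finset.mem_insert, Finset.mem_singleton, not_or] at hx'
  exact ⟨x, by simpa using hx, hx'⟩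

lemma not_isClique_neighborSet [Fintype V] [DecidableRel G.Adj]
    (h : G.cliqueNum ≤ G.minDegree) (v : V) : ¬ G.IsClique (G.neighborSet v) := by
  classical
  intro hv
  have hclique : G.IsClique (insert v (G.neighborFinset v) : Finset V) := by
    rw [Finset.coe_insert, G.coe_neighborFinset]
    exact hv.insert fun b hb _ => hb
  have := hclique.card_le_cliqueNum
  rw [Finset.card_insert_of_notMem (by simp), G.card_neighborFinset_eq_degree] at this
  have := G.minDegree_le_degree v
  omega

/-- Otherwise all neighbours of `v` except `c` are adjacent to `c`, and any two of them that are not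
adjacent would have both `v` and `c` as common neighbours. -/
lemma exists_adj_not_adj
    (heq : ∀ a b x y, a ≠ b → ¬ G.Adj a b → G.Adj a x → G.Adj b x → G.Adj a y → G.Adj b y → x = y)
    (v c : V) (hvc : G.Adj v c) (hv : ¬ G.IsClique (G.neighborSet v)) :
    ∃ x, G.Adj v x ∧ x ≠ c ∧ ¬ G.Adj c x := by
  by_contra! h
  refine hv fun x hx y hy hxy => ?_
  by_contra hadj
  by_cases hxc : x = c
  · exact hadj (hxc ▸ h y hy fun hyc => hxy (hxc.trans hyc.symm))
  by_cases hyc : y = c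
  · exact hadj (hyc ▸ (h x hx hxc).symm)
  exact hvc.ne (heq x y v c hxy hadj hx.symm hy.symm (h x hx hxc).symm (h y hy hyc).symm)

end InducedSearch

theorem theorem1 {V : Type*} [Fintype V] (G : SimpleGraph V) [DecidableRel G.Adj]
    (hconn : G.Connected)
    (hP7 : InducedFree (SimpleGraph.pathGraph 7) G)
    (hC4 : InducedFree (SimpleGraph.cycleGraph 4) G)
    (hdiamond : InducedFree diamondGraph G)
    (hcut : ¬ ∃ K : Set V, IsCliqueCutset G K)
    (hPetersen : ¬ Nonempty (G ≃g petersenGraph))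
    (hF : ¬ Nonempty (G ≃g sevenHoleGraphF)) :
    G.minDegree ≤ max 2 (G.cliqueNum - 1) := by
  by_contra! h
  rw [max_lt_iff] at h
  have heq : ∀ a b x y, a ≠ b → ¬ G.Adj a b → G.Adj a x → G.Adj b x → G.Adj a y → G.Adj b y →
      x = y := fun _ _ _ _ hne hab => InducedSearch.eq_of_adj_of_adj hC4 hdiamond hne hab
  have hG : InducedSearch.Admissible G := ⟨heq, InducedSearch.exists_adj_ne_ne h.1, fun v c hvc =>
    InducedSearch.exists_adj_not_adj heq v c hvc
      (InducedSearch.not_isClique_neighborSet (by omega) v)⟩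
  exact hPetersen (hG.nonempty_iso_petersenGraph hconn hP7)
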